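/- Let $q\ge 2$, let $m,k>0$ be real numbers, and let $D_{ij},R_{ij}\ge 0$ ($1\le i,j\le q$) be real numbers with $D_{ij}=D_{ji}$, $R_{ij}=R_{ji}$ and $D_{ii}=R_{ii}=0$. Consider the array of $q$ coupled scalar oscillators $$m\ddot x_i+kx_i+\sum_{j=1}^q D_{ij}(\dot x_i-\dot x_j)+\sum_{j=1}^q R_{ij}(x_i-x_j)=0,\qquad i=1,\dots,q,$$ with $x_i(t)\in\mathbb R$. The array is said to synchronize if, for every solution (i.e. for all initial conditions), $|x_i(t)-x_j(t)|\to 0$ as $t\to\infty$ for all $i,j$. For weights $W_{ij}$ let $\mathrm{lap}(W_{ij})$ be the $q\times q$ matrix with off-diagonal entries $-W_{ij}$ and diagonal entries $\sum_l W_{il}$, and put $L_d=\mathrm{lap}(m^{-1/2}D_{ij}m^{-1/2})$, $L_r=\mathrm{lap}(m^{-1/2}R_{ij}m^{-1/2})$. For a complex $q\times q$ matrix $X$ let $\lambda_1(X),\dots,\lambda_q(X)$ be its eigenvalues, repeated according to algebraic multiplicity and ordered so that $\mathrm{Re}\,\lambda_1(X)\le\dots\le\mathrm{Re}\,\lambda_q(X)$.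 Let $\mathrm{j}=\sqrt{-1}$. Then: 1. The array synchronizes if and only if $\mathrm{Re}\,\lambda_2(L_d+\mathrm{j}L_r)>0$. 2. If $R_{ij}=0$ for all $i,j$ (so that $L_r=0$), then $\lambda_2(L_d)$ is real, and the array synchronizes if and only if $\lambda_2(L_d)>0$. -/

import Mathlib

open Filter Topology

noncomputable section

namespace OscillatorArray

/-- The Laplacian matrix `lap (W i j)` of an array of (scalar) weights: off-diagonal entries
`-W i j`, diagonal entries `∑ l, W i l`. -/
def lap {q : ℕ} (W : Fin q → Fin q → ℝ) : Matrix (Fin q) (Fin q) ℝ :=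
  Matrix.of fun i j => if i = j then ∑ l, W i l else -W i j

/-- `x i t` is the position of the `i`-th oscillator at time `t`.  The family `x` solves
`m x_i'' + k x_i + ∑_j D_ij (x_i' - x_j') + ∑_j R_ij (x_i - x_j) = 0` for all `i`;
here `v` is the velocity and `a` the acceleration. -/
def IsSolution {q : ℕ} (m k : ℝ) (D R : Fin q → Fin q → ℝ) (x : Fin q → ℝ → ℝ) : Prop :=
  ∃ v a : Fin q → ℝ → ℝ,
    (∀ i t, HasDerivAt (x i) (v i t) t) ∧
    (∀ i t, HasDerivAt (v i) (a i t) t) ∧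
    ∀ i t, m * a i t + k * x i t + ∑ j, D i j * (v i t - v j t)
      + ∑ j, R i j * (x i t - x j t) = 0

/-- The array synchronizes: along every solution (that is, for all initial conditions) all
mutual distances tend to zero. -/
def Synchronizes {q : ℕ} (m k : ℝ) (D R : Fin q → Fin q → ℝ) : Prop :=
  ∀ x : Fin q → ℝ → ℝ, IsSolution m k D R x →
    ∀ i j, Tendsto (fun t => |x i t - x j t|) atTop (𝓝 0)

/-- The Laplacian `lap (m^{-1/2} W_ij m^{-1/2})` of mass-normalized coupling weights. -/
def normLap {q : ℕ} (m : ℝ) (W : Fin q → Fin q → ℝ) : Matrix (Fin q) (Fin q) ℝ :=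
  lap fun i j => (√m)⁻¹ * W i j * (√m)⁻¹

/-- The eigenvalues of a complex matrix, repeated according to algebraic multiplicity and listed
in the order of nondecreasing real part. -/
def eigList {N : ℕ} (X : Matrix (Fin N) (Fin N) ℂ) : List ℂ :=
  X.charpoly.roots.toList.mergeSort fun a b => decide (a.re ≤ b.re)

theorem eigList_length {N : ℕ} (X : Matrix (Fin N) (Fin N) ℂ) : (eigList X).length = N := by
  rw [eigList, List.length_mergeSort, Multiset.length_toList,
    (IsAlgClosed.splits X.charpoly).natDegree_eq_card_roots.symm,
    Matrix.charpoly_natDegree_eq_dim, Fintype.card_fin]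

theorem eigList_coe {N : ℕ} (X : Matrix (Fin N) (Fin N) ℂ) :
    (eigList X : Multiset ℂ) = X.charpoly.roots := by
  rw [eigList, Multiset.coe_eq_coe.2 (List.mergeSort_perm _ _), Multiset.coe_toList]

/-- `eig X i` is the eigenvalue of `X` at position `i`, counted from `0`, with respect to
nondecreasing real part; so `eig X 1` is the second one, `λ₂(X)`. -/
def eig {N : ℕ} (X : Matrix (Fin N) (Fin N) ℂ) (i : Fin N) : ℂ :=
  (eigList X).get (i.cast (eigList_length X).symm)

theorem eig_re_mono {N : ℕ} (X : Matrix (Fin N) (Fin N) ℂ) :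
    Monotone fun i => (eig X i).re := by
  have h : (eigList X).Pairwise fun a b => a.re ≤ b.re := by
    have h0 := List.pairwise_mergeSort (le := fun a b : ℂ => decide (a.re ≤ b.re))
      (fun a b c h1 h2 => by simp at *; linarith)
      (fun a b => by simpa using le_total a.re b.re) X.charpoly.roots.toList
    exact h0.imp (by simp)
  intro i j hij
  rcases hij.eq_or_lt with rfl | hlt
  · exact le_rfl
  · exact List.pairwise_iff_get.1 h _ _ (by simpa using hlt)

/-- A real matrix regarded as a complex one. -/
def toC {N : ℕ} (X : Matrix (Fin N) (Fin N) ℝ) : Matrix (Fin N) (Fin N) ℂ :=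
  X.map fun a => (a : ℂ)

end OscillatorArray

end

/-!
Dividing by the mass, the array reads `x'' + P x' + K x = 0` with `P = L_d` and `K = k/m + L_r`.
Both Laplacians annihilate the constant vectors, so adding the all-ones matrix `J` to `P` damps the
common motion without affecting the differences `x_i - x_j`: the array synchronizes iff every
solution of `x'' + (P + J) x' + K x = 0` decays. As `P + J` is positive semidefinite and `K`
positive definite, a quadratic pencil argument shows that this happens iff no eigenvector of `L_r`
is annihilated by `P + J`.

The same condition says that no eigenvalue of `L_d + J + i L_r` lies on the imaginary axis, that is,
that all of them have positive real part. By Brauer deflation, adding `J` to `L_d + i L_r` moves one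
eigenvalue `0` to `q` and keeps all others, so this amounts to `0 < Re λ₂(L_d + i L_r)`.
-/

namespace OscillatorArray

open Matrix Polynomial
open scoped ComplexOrder

section LinearODE

variable {E : Type*} [NormedAddCommGroup E] [NormedSpace ℂ E]

theorem norm_le_of_hasDerivAt_smul_add {u f : ℝ → E} {c : ℂ} {ε T : ℝ}
    (hu : ∀ t, HasDerivAt u (c • u t + f t) t) (hf : ∀ t, T ≤ t → ‖f t‖ ≤ -c.re * ε) {t : ℝ}
    (ht : T ≤ t) : ‖u t‖ ≤ Real.exp (c.re * (t - T)) * (‖u T‖ - ε) + ε := by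
  have hphase : ∀ s : ℝ, HasDerivAt (fun s : ℝ => -c * ((s - T : ℝ) : ℂ)) (-c) s := fun s => by
    simpa using ((hasDerivAt_id s).sub_const T).ofReal_comp.const_mul (-c)
  have hfactor : ∀ s : ℝ, HasDerivAt (fun s : ℝ => Complex.exp (-c * ((s - T : ℝ) : ℂ)) • u s)
      (Complex.exp (-c * ((s - T : ℝ) : ℂ)) • f s) s := fun s => by
    refine ((hphase s).cexp.smul (hu s)).congr_deriv ?_
    module
  have hnorm : ∀ s : ℝ, ‖Complex.exp (-c * ((s - T : ℝ) : ℂ))‖ = Real.exp (-c.re * (s - T)) := by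
    simp [Complex.norm_exp]
  have hB : ∀ s : ℝ, HasDerivAt (fun s : ℝ => ‖u T‖ + ε * (Real.exp (-c.re * (s - T)) - 1))
      (ε * (Real.exp (-c.re * (s - T)) * -c.re)) s := fun s => by
    have hexp := (((hasDerivAt_id s).sub_const T).const_mul (-c.re)).exp
    simpa using ((hexp.sub_const 1).const_mul ε).const_add ‖u T‖
  have hbound : Real.exp (-c.re * (t - T)) * ‖u t‖
      ≤ ‖u T‖ + ε * (Real.exp (-c.re * (t - T)) - 1) := by
    rw [← hnorm, ← norm_smul, hnorm]
    refine image_norm_le_of_norm_deriv_right_le_deriv_boundary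
      (fun s _ => (hfactor s).continuousAt.continuousWithinAt)
      (fun s _ => (hfactor s).hasDerivWithinAt) (by simp) hB (fun s hs => ?_)
      (Set.right_mem_Icc.2 ht)
    rw [norm_smul, hnorm, mul_left_comm, mul_comm ε]
    exact mul_le_mul_of_nonneg_left (hf s hs.1) (Real.exp_pos _).le
  have hinv : Real.exp (c.re * (t - T)) * Real.exp (-c.re * (t - T)) = 1 := by
    rw [← Real.exp_add, neg_mul, add_neg_cancel, Real.exp_zero]
  linear_combination Real.exp (c.re * (t - T)) * hbound + (ε - ‖u t‖) * hinv

theorem tendsto_zero_of_hasDerivAt_smul_add {u f : ℝ → E} {c : ℂ} (hc : c.re < 0)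
    (hu : ∀ t, HasDerivAt u (c • u t + f t) t) (hf : Tendsto f atTop (𝓝 0)) :
    Tendsto u atTop (𝓝 0) := by
  rw [NormedAddGroup.tendsto_nhds_zero]
  intro ε hε
  have hδ : 0 < -c.re * (ε / 2) := mul_pos (neg_pos.2 hc) (half_pos hε)
  obtain ⟨T, hT⟩ := eventually_atTop.1 (NormedAddGroup.tendsto_nhds_zero.1 hf _ hδ)
  have hexp : Tendsto (fun t => Real.exp (c.re * (t - T))) atTop (𝓝 0) :=
    Real.tendsto_exp_atBot.comp
      ((tendsto_atTop_add_const_right _ (-T) tendsto_id).const_mul_atTop_of_neg hc)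
  have hlim : Tendsto (fun t => Real.exp (c.re * (t - T)) * (‖u T‖ - ε / 2) + ε / 2) atTop
      (𝓝 (ε / 2)) := by
    simpa using (hexp.mul_const (‖u T‖ - ε / 2)).add_const (ε / 2)
  filter_upwards [hlim.eventually_lt_const (half_lt_self hε), eventually_ge_atTop T] with t hlt ht
  exact (norm_le_of_hasDerivAt_smul_add hu (fun s hs => (hT s hs).le) ht).trans_lt hlt

/-- Peeling off one factor `X - c` of the annihilating polynomial leaves `z' = c z + f` where `f`
solves the same equation and is annihilated by the remaining factors. -/
theorem tendsto_zero_of_aeval_prod_X_sub_C (M : E →L[ℂ] E) {s : Multiset ℂ}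
    (hs : ∀ c ∈ s, c.re < 0) {z : ℝ → E} (hz : ∀ t, HasDerivAt z (M (z t)) t)
    (hann : ∀ t, aeval M (s.map fun c => X - C c).prod (z t) = 0) : Tendsto z atTop (𝓝 0) := by
  induction s using Multiset.induction_on generalizing z with
  | empty =>
    have hzero : z = 0 := funext fun t => by simpa using hann t
    exact hzero ▸ tendsto_const_nhds
  | cons c s ih =>
    have hrest : Tendsto (fun t => (M - algebraMap ℂ _ c) (z t)) atTop (𝓝 0) := by
      refine ih (fun d hd => hs d (Multiset.mem_cons_of_mem hd)) (fun t => ?_) fun t => ?_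
      · have hcomp : HasDerivAt (fun t => (M - algebraMap ℂ _ c) (z t))
            ((M - algebraMap ℂ _ c) (M (z t))) t :=
          ((M - algebraMap ℂ (E →L[ℂ] E) c).restrictScalars ℝ).hasFDerivAt.comp_hasDerivAt t (hz t)
        exact hcomp.congr_deriv (by simp [Algebra.algebraMap_eq_smul_one])
      · have hcons := hann t
        rw [Multiset.map_cons, Multiset.prod_cons, mul_comm, map_mul] at hcons
        simpa using hcons
    refine tendsto_zero_of_hasDerivAt_smul_add (hs c (Multiset.mem_cons_self c s)) (fun t => ?_)
      hrest
    exact (hz t).congr_deriv (by simp [Algebra.algebraMap_eq_smul_one])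

theorem tendsto_zero_of_forall_hasEigenvalue_re_neg [FiniteDimensional ℂ E] {M : Module.End ℂ E}
    (hM : ∀ c, M.HasEigenvalue c → c.re < 0) {z : ℝ → E} (hz : ∀ t, HasDerivAt z (M (z t)) t) :
    Tendsto z atTop (𝓝 0) := by
  refine tendsto_zero_of_aeval_prod_X_sub_C (Module.End.toContinuousLinearMap E M)
    (s := M.charpoly.roots) (fun c hc => hM c ?_) hz fun t => ?_
  · exact (M.hasEigenvalue_iff_isRoot_charpoly c).2 (isRoot_of_mem_roots hc)
  · rw [← (IsAlgClosed.splits M.charpoly).eq_prod_roots_of_monic M.charpoly_monic,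
      aeval_algHom_apply, LinearMap.aeval_self_charpoly, map_zero, _root_.zero_apply]

end LinearODE

section UndampedModes

variable {n : Type*} [Fintype n]

/-- No eigenvector of the stiffness matrix `K` lies in the kernel of the damping matrix `P`. Only
real eigenvalues are mentioned, as `K` is Hermitian wherever the notion is used. -/
def NoUndampedMode (P K : Matrix n n ℂ) : Prop :=
  ∀ (w : n → ℂ) (ρ : ℝ), P *ᵥ w = 0 → K *ᵥ w = (ρ : ℂ) • w → w = 0

theorem noUndampedMode_smul_one_add_iff [DecidableEq n] {P K : Matrix n n ℂ} (κ : ℝ) :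
    NoUndampedMode P ((κ : ℂ) • 1 + K) ↔ NoUndampedMode P K := by
  constructor <;> intro h w ρ hPw hKw
  · refine h w (κ + ρ) hPw ?_
    rw [add_mulVec, smul_mulVec, one_mulVec, hKw, Complex.ofReal_add, add_smul]
  · refine h w (ρ - κ) hPw ?_
    rw [add_mulVec, smul_mulVec, one_mulVec] at hKw
    rw [Complex.ofReal_sub, sub_smul, ← hKw, add_sub_cancel_left]

theorem exists_pos_eq_star_dotProduct_self {x : n → ℂ} (hx : x ≠ 0) :
    ∃ r : ℝ, 0 < r ∧ star x ⬝ᵥ x = r := by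
  obtain ⟨r, hr, h⟩ := RCLike.pos_iff_exists_ofReal.1 (dotProduct_star_self_pos_iff.2 hx)
  exact ⟨r, hr, h.symm⟩

theorem exists_pos_eq_star_dotProduct_mulVec {K : Matrix n n ℂ} (hK : K.PosDef) {x : n → ℂ}
    (hx : x ≠ 0) : ∃ r : ℝ, 0 < r ∧ star x ⬝ᵥ K *ᵥ x = r := by
  obtain ⟨r, hr, h⟩ := RCLike.pos_iff_exists_ofReal.1 (hK.dotProduct_mulVec_pos hx)
  exact ⟨r, hr, h.symm⟩

theorem mulVec_eq_zero_or_exists_pos {P : Matrix n n ℂ} (hP : P.PosSemidef) (x : n → ℂ) :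
    P *ᵥ x = 0 ∨ ∃ r : ℝ, 0 < r ∧ star x ⬝ᵥ P *ᵥ x = r := by
  rw [← hP.dotProduct_mulVec_zero_iff]
  rcases (hP.dotProduct_mulVec_nonneg x).eq_or_lt with hzero | hpos
  · exact .inl hzero.symm
  · obtain ⟨r, hr, h⟩ := RCLike.pos_iff_exists_ofReal.1 hpos
    exact .inr ⟨r, hr, h.symm⟩

theorem pos_of_posDef_of_mulVec_eq_smul {K : Matrix n n ℂ} (hK : K.PosDef) {w : n → ℂ} (hw : w ≠ 0)
    {ρ : ℝ} (h : K *ᵥ w = (ρ : ℂ) • w) : 0 < ρ := by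
  obtain ⟨r, hr, hwr⟩ := exists_pos_eq_star_dotProduct_self hw
  obtain ⟨s, hs, hws⟩ := exists_pos_eq_star_dotProduct_mulVec hK hw
  rw [h, dotProduct_smul, hwr, smul_eq_mul] at hws
  exact pos_of_mul_pos_left ((by exact_mod_cast hws : ρ * r = s) ▸ hs) hr.le

theorem re_neg_of_quadratic_eq_zero {a b d : ℝ} (ha : 0 < a) (hb : 0 < b) (hd : 0 < d) {c : ℂ}
    (h : c ^ 2 * a + c * b + d = 0) : c.re < 0 := by
  have hre := congrArg Complex.re h
  have him := congrArg Complex.im h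
  simp only [sq, Complex.add_re, Complex.add_im, Complex.mul_re, Complex.mul_im, Complex.ofReal_re,
    Complex.ofReal_im, Complex.zero_re, Complex.zero_im] at hre him
  by_contra! hc
  have hfactor : c.im * (2 * c.re * a + b) = 0 := by linarith
  have hreal : c.im = 0 := (mul_eq_zero.1 hfactor).resolve_right (by positivity)
  rw [hreal] at hre
  nlinarith [mul_nonneg hc hb.le, mul_nonneg (sq_nonneg c.re) ha.le]

theorem re_neg_of_quadratic_pencil_eq_zero {P K : Matrix n n ℂ} (hP : P.PosSemidef)
    (hK : K.PosDef) (hmode : NoUndampedMode P K) {c : ℂ} {x : n → ℂ} (hx : x ≠ 0)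
    (h : c ^ 2 • x + c • P *ᵥ x + K *ᵥ x = 0) : c.re < 0 := by
  obtain ⟨a, ha, hxa⟩ := exists_pos_eq_star_dotProduct_self hx
  obtain ⟨d, hd, hxd⟩ := exists_pos_eq_star_dotProduct_mulVec hK hx
  have hform : c ^ 2 * a + c * (star x ⬝ᵥ P *ᵥ x) + d = 0 := by
    simpa only [dotProduct_add, dotProduct_smul, smul_eq_mul, hxa, hxd, dotProduct_zero] using
      congrArg (star x ⬝ᵥ ·) h
  rcases mulVec_eq_zero_or_exists_pos hP x with hPx | ⟨b, hb, hxb⟩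
  · rw [hPx, dotProduct_zero, mul_zero, add_zero] at hform
    have hsq : c ^ 2 = -((d / a : ℝ) : ℂ) := by
      have : (a : ℂ) ≠ 0 := Complex.ofReal_ne_zero.2 ha.ne'
      push_cast
      field_simp
      linear_combination hform
    rw [hPx, smul_zero, add_zero, hsq, neg_smul, neg_add_eq_zero] at h
    exact absurd (hmode x _ hPx h.symm) hx
  · exact re_neg_of_quadratic_eq_zero ha hb hd (hxb ▸ hform)

theorem mem_roots_charpoly_iff {F : Type*} [Field F] [DecidableEq n] {A : Matrix n n F} {c : F} :
    c ∈ A.charpoly.roots ↔ ∃ x, x ≠ 0 ∧ A *ᵥ x = c • x := by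
  rw [mem_roots A.charpoly_monic.ne_zero, IsRoot, eval_charpoly, ← exists_mulVec_eq_zero_iff]
  simp only [sub_mulVec, scalar_apply, ← smul_one_eq_diagonal, smul_mulVec, one_mulVec, sub_eq_zero,
    eq_comm (a := c • _)]

theorem forall_roots_add_I_smul_re_pos_iff [DecidableEq n] {P Q : Matrix n n ℂ}
    (hP : P.PosSemidef) (hQ : Q.IsHermitian) :
    (∀ c ∈ (P + Complex.I • Q).charpoly.roots, 0 < c.re) ↔ NoUndampedMode P Q := by
  simp only [mem_roots_charpoly_iff]
  constructor
  · intro h w ρ hPw hQw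
    by_contra hw
    refine absurd (h (Complex.I * ρ) ⟨w, hw, ?_⟩) (by simp)
    rw [add_mulVec, smul_mulVec, hPw, hQw, zero_add, smul_smul]
  · rintro hmode c ⟨x, hx, h⟩
    obtain ⟨a, ha, hxa⟩ := exists_pos_eq_star_dotProduct_self hx
    have hform : star x ⬝ᵥ P *ᵥ x + Complex.I * (star x ⬝ᵥ Q *ᵥ x) = c * a := by
      simpa only [add_mulVec, smul_mulVec, dotProduct_add, dotProduct_smul, smul_eq_mul, hxa] using
        congrArg (star x ⬝ᵥ ·) h
    have him : (star x ⬝ᵥ Q *ᵥ x).im = 0 := hQ.im_star_dotProduct_mulVec_self x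
    have hre : (star x ⬝ᵥ P *ᵥ x).re = c.re * a := by
      simpa [him] using congrArg Complex.re hform
    rcases mulVec_eq_zero_or_exists_pos hP x with hPx | ⟨b, hb, hxb⟩
    · rw [hPx, dotProduct_zero, Complex.zero_re, eq_comm, mul_eq_zero_iff_right ha.ne'] at hre
      have hcI : c = Complex.I * c.im := Complex.ext (by simp [hre]) (by simp)
      rw [add_mulVec, hPx, zero_add, smul_mulVec, hcI, mul_smul] at h
      exact absurd (hmode x c.im hPx (smul_right_injective _ Complex.I_ne_zero h)) hx
    · rw [hxb, Complex.ofReal_re] at hre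
      exact pos_of_mul_pos_left (hre ▸ hb) ha.le

end UndampedModes

section SecondOrderMotion

variable {l n : Type*} [Fintype n] {P K : Matrix n n ℂ} {y : ℝ → n → ℂ}

/-- The curve `y` in `ℂⁿ` solves `y'' + P y' + K y = 0`; here `v` is the velocity and `a` the
acceleration. -/
def IsMotion (P K : Matrix n n ℂ) (y : ℝ → n → ℂ) : Prop :=
  ∃ v a : ℝ → n → ℂ, (∀ t, HasDerivAt y (v t) t) ∧ (∀ t, HasDerivAt v (a t) t) ∧
    ∀ t, a t + P *ᵥ v t + K *ᵥ y t = 0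

theorem hasDerivAt_mulVec [Finite l] (T : Matrix l n ℂ) {y : ℝ → n → ℂ} {v : n → ℂ} {t : ℝ}
    (hy : HasDerivAt y v t) : HasDerivAt (fun t => T *ᵥ y t) (T *ᵥ v) t := by
  have := Fintype.ofFinite l
  exact (T.mulVecLin.toContinuousLinearMap.restrictScalars ℝ).hasFDerivAt.comp_hasDerivAt t hy

theorem IsMotion.mulVec [Fintype l] {P' K' : Matrix l l ℂ} {T : Matrix l n ℂ}
    (hP : T * P = P' * T) (hK : T * K = K' * T) (hy : IsMotion P K y) :
    IsMotion P' K' fun t => T *ᵥ y t := by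
  obtain ⟨v, a, hv, ha, heq⟩ := hy
  refine ⟨fun t => T *ᵥ v t, fun t => T *ᵥ a t, fun t => hasDerivAt_mulVec T (hv t),
    fun t => hasDerivAt_mulVec T (ha t), fun t => ?_⟩
  rw [mulVec_mulVec, mulVec_mulVec, ← hP, ← hK, ← mulVec_mulVec, ← mulVec_mulVec, ← mulVec_add,
    ← mulVec_add, heq, mulVec_zero]

/-- The first-order form of the equation `y'' + P y' + K y = 0`, acting on pairs of a position and a
velocity. -/
def companion (P K : Matrix n n ℂ) : Module.End ℂ ((n → ℂ) × (n → ℂ)) :=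
  (LinearMap.snd ℂ _ _).prod
    (-(P.mulVecLin ∘ₗ LinearMap.snd ℂ _ _ + K.mulVecLin ∘ₗ LinearMap.fst ℂ _ _))

theorem companion_apply (z : (n → ℂ) × (n → ℂ)) :
    companion P K z = (z.2, -(P *ᵥ z.2 + K *ᵥ z.1)) :=
  rfl

theorem exists_quadratic_pencil_eq_zero_of_hasEigenvalue_companion {c : ℂ}
    (hc : (companion P K).HasEigenvalue c) :
    ∃ x, x ≠ 0 ∧ c ^ 2 • x + c • P *ᵥ x + K *ᵥ x = 0 := by
  obtain ⟨⟨x, u⟩, hxu⟩ := hc.exists_hasEigenvector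
  have heig := hxu.apply_eq_smul
  rw [companion_apply, Prod.smul_mk, Prod.mk.injEq] at heig
  obtain ⟨rfl, heq⟩ := heig
  refine ⟨x, ?_, ?_⟩
  · rintro rfl
    exact hxu.2 (by simp)
  · rw [mulVec_smul, smul_smul, neg_eq_iff_add_eq_zero] at heq
    rw [← heq]
    module

theorem IsMotion.tendsto_zero (hP : P.PosSemidef) (hK : K.PosDef) (hmode : NoUndampedMode P K)
    (hy : IsMotion P K y) : Tendsto y atTop (𝓝 0) := by
  obtain ⟨v, a, hv, ha, heq⟩ := hy
  have hphase : Tendsto (fun t => (y t, v t)) atTop (𝓝 0) := by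
    refine tendsto_zero_of_forall_hasEigenvalue_re_neg (M := companion P K) (fun c hc => ?_)
      fun t => ?_
    · obtain ⟨x, hx, h⟩ := exists_quadratic_pencil_eq_zero_of_hasEigenvalue_companion hc
      exact re_neg_of_quadratic_pencil_eq_zero hP hK hmode hx h
    · have hacc : a t = -(P *ᵥ v t + K *ᵥ y t) :=
        eq_neg_of_add_eq_zero_left (by rw [← add_assoc, heq])
      rw [companion_apply, ← hacc]
      exact (hv t).prodMk (ha t)
  exact hphase.fst_nhds

theorem isMotion_exp_smul {w : n → ℂ} {ν : ℝ} (hPw : P *ᵥ w = 0)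
    (hKw : K *ᵥ w = ((ν ^ 2 : ℝ) : ℂ) • w) :
    IsMotion P K fun t => Complex.exp (ν * t * Complex.I) • w := by
  have hexp : ∀ t : ℝ, HasDerivAt (fun t : ℝ => Complex.exp (ν * t * Complex.I))
      (ν * Complex.I * Complex.exp (ν * t * Complex.I)) t := fun t => by
    have hlin : HasDerivAt (fun t : ℝ => ν * t * Complex.I) (ν * Complex.I) t := by
      simpa using ((hasDerivAt_id t).ofReal_comp.const_mul (ν : ℂ)).mul_const Complex.I
    simpa only [mul_comm] using hlin.cexp
  refine ⟨_, _, fun t => (hexp t).smul_const w, fun t => ((hexp t).const_mul _).smul_const w,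
    fun t => ?_⟩
  rw [mulVec_smul, mulVec_smul, hPw, hKw, smul_zero, add_zero, smul_smul, ← add_smul]
  refine smul_eq_zero_of_left ?_ w
  push_cast
  linear_combination (ν : ℂ) ^ 2 * Complex.exp (ν * t * Complex.I) * Complex.I_sq

end SecondOrderMotion

section Consensus

variable {n : Type*} [Fintype n] {P K : Matrix n n ℂ} {y : ℝ → n → ℂ}

/-- The all-ones matrix. Adding it to the damping also damps the common motion of all coordinates
while leaving their differences untouched. -/
def allOnes (n : Type*) : Matrix n n ℂ :=
  vecMulVec 1 1

theorem posSemidef_allOnes {ι : Type*} [Finite ι] : (allOnes ι).PosSemidef := by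
  simpa [allOnes] using posSemidef_vecMulVec_self_star (1 : ι → ℂ)

theorem allOnes_mulVec_apply (x : n → ℂ) (i : n) : (allOnes n *ᵥ x) i = ∑ j, x j := by
  rw [allOnes, vecMulVec_mulVec, one_dotProduct]
  simp

theorem allOnes_mul_self : allOnes n * allOnes n = (Fintype.card n : ℂ) • allOnes n := by
  rw [allOnes, vecMulVec_mul_vecMulVec, one_dotProduct_one, vecMulVec_smul]

theorem mul_allOnes_eq_zero (h : P *ᵥ 1 = 0) : P * allOnes n = 0 := by
  rw [allOnes, mul_vecMulVec, h, zero_vecMulVec]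

theorem allOnes_mul_eq_zero (hP : P.IsHermitian) (h : P *ᵥ 1 = 0) : allOnes n * P = 0 := by
  rw [← conjTranspose_inj, conjTranspose_mul, hP.eq, posSemidef_allOnes.isHermitian.eq,
    mul_allOnes_eq_zero h, conjTranspose_zero]

theorem mulVec_eq_zero_of_add_allOnes [Nonempty n] (hP : P.IsHermitian) (hP1 : P *ᵥ 1 = 0)
    {w : n → ℂ} (h : (P + allOnes n) *ᵥ w = 0) : P *ᵥ w = 0 ∧ allOnes n *ᵥ w = 0 := by
  have hJ : (Fintype.card n : ℂ) • allOnes n *ᵥ w = 0 := by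
    rw [← smul_mulVec, ← allOnes_mul_self, ← zero_add (allOnes n * _),
      ← allOnes_mul_eq_zero hP hP1, ← mul_add, ← mulVec_mulVec, h, mulVec_zero]
  have hJw := (smul_eq_zero.1 hJ).resolve_left (Nat.cast_ne_zero.2 Fintype.card_ne_zero)
  rw [add_mulVec, hJw, add_zero] at h
  exact ⟨h, hJw⟩

theorem eq_zero_of_allOnes_mulVec_eq_zero [Nonempty n] {w : n → ℂ} (h : allOnes n *ᵥ w = 0)
    (hconst : ∀ i j, w i = w j) : w = 0 := by
  funext i
  have hsum := congrFun h i
  rw [allOnes_mulVec_apply, Finset.sum_congr rfl fun j _ => hconst j i] at hsum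
  simpa using hsum

/-- The projection `x ↦ x - mean x`, which removes the common motion of all coordinates. -/
noncomputable def centering (n : Type*) [Fintype n] [DecidableEq n] : Matrix n n ℂ :=
  1 - (Fintype.card n : ℂ)⁻¹ • allOnes n

theorem centering_mulVec_apply_sub [DecidableEq n] (x : n → ℂ) (i j : n) :
    (centering n *ᵥ x) i - (centering n *ᵥ x) j = x i - x j := by
  simp [centering, sub_mulVec, smul_mulVec, allOnes_mulVec_apply]

theorem allOnes_mul_centering [DecidableEq n] [Nonempty n] : allOnes n * centering n = 0 := by
  rw [centering, mul_sub, mul_one, Matrix.mul_smul, allOnes_mul_self,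
    inv_smul_smul₀ (Nat.cast_ne_zero.2 Fintype.card_ne_zero), sub_self]

theorem IsMotion.centering [DecidableEq n] [Nonempty n] (hP : P.IsHermitian) (hP1 : P *ᵥ 1 = 0)
    (hK : Commute (allOnes n) K) (hy : IsMotion P K y) :
    IsMotion (P + allOnes n) K fun t => centering n *ᵥ y t := by
  refine hy.mulVec ?_ (((Commute.one_left K).sub_left (hK.smul_left _)).eq)
  rw [add_mul, allOnes_mul_centering, add_zero, OscillatorArray.centering, sub_mul, mul_sub,
    Matrix.smul_mul, Matrix.mul_smul, allOnes_mul_eq_zero hP hP1, mul_allOnes_eq_zero hP1,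
    one_mul, mul_one]

theorem forall_isMotion_tendsto_sub_iff (hP : P.PosSemidef) (hP1 : P *ᵥ 1 = 0) (hK : K.PosDef)
    (hcomm : Commute (allOnes n) K) :
    (∀ y, IsMotion P K y → ∀ i j, Tendsto (fun t => y t i - y t j) atTop (𝓝 0)) ↔
      NoUndampedMode (P + allOnes n) K := by
  classical
  constructor
  · intro hsync w ρ hPw hKw
    cases isEmpty_or_nonempty n
    · exact Subsingleton.elim _ _
    by_contra hw
    obtain ⟨hPw, hJw⟩ := mulVec_eq_zero_of_add_allOnes hP.isHermitian hP1 hPw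
    have hρ := pos_of_posDef_of_mulVec_eq_smul hK hw hKw
    have hmotion := isMotion_exp_smul (ν := √ρ) hPw (by rwa [Real.sq_sqrt hρ.le])
    refine hw (eq_zero_of_allOnes_mulVec_eq_zero hJw fun i j => ?_)
    have hnorm := (hsync _ hmotion i j).norm
    simp only [Pi.smul_apply, ← smul_sub, norm_smul, ← Complex.ofReal_mul,
      Complex.norm_exp_ofReal_mul_I, one_mul, norm_zero] at hnorm
    exact sub_eq_zero.1 (norm_eq_zero.1 (tendsto_nhds_unique tendsto_const_nhds hnorm))
  · intro hmode y hy i j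
    have : Nonempty n := ⟨i⟩
    have hlim := (hy.centering hP.isHermitian hP1 hcomm).tendsto_zero
      (hP.add posSemidef_allOnes) hK hmode
    simpa [centering_mulVec_apply_sub] using
      (tendsto_pi_nhds.1 hlim i).sub (tendsto_pi_nhds.1 hlim j)

end Consensus

section Deflation

variable {n : Type*} [Fintype n] [DecidableEq n]

theorem charpoly_mul_charpoly_of_mul_eq_zero {S : Type*} [CommRing S] {A B : Matrix n n S}
    (h : A * B = 0) : A.charpoly * B.charpoly = X ^ Fintype.card n * (A + B).charpoly := by
  have hfactor : charmatrix A * charmatrix B = (X : S[X]) • charmatrix (A + B) := by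
    have hmap : A.map C * B.map C = 0 := by
      rw [← Matrix.map_mul, h, Matrix.map_zero _ (map_zero C)]
    simp only [charmatrix, RingHom.mapMatrix_apply, Matrix.map_add _ C.map_add, scalar_apply,
      ← smul_one_eq_diagonal, sub_mul, mul_sub, Matrix.smul_mul, Matrix.mul_smul, one_mul, mul_one,
      hmap]
    module
  rw [charpoly, charpoly, charpoly, ← det_mul, hfactor, det_smul]

theorem X_sub_C_mul_charpoly_eq_X_mul_charpoly_add_vecMulVec {S : Type*} [CommRing S]
    {A : Matrix n n S} {u v : n → S} (h : A *ᵥ u = 0) :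
    (X - C (u ⬝ᵥ v)) * A.charpoly = X * (A + vecMulVec u v).charpoly := by
  have hmul : A * vecMulVec u v = 0 := by rw [mul_vecMulVec, h, zero_vecMulVec]
  have hrank : X * (vecMulVec u v).charpoly = X ^ Fintype.card n * (X - C (u ⬝ᵥ v)) := by
    cases isEmpty_or_nonempty n
    · simp [Matrix.charpoly]
    · rw [charpoly_vecMulVec, smul_eq_C_mul, mul_sub, mul_left_comm,
        mul_pow_sub_one Fintype.card_ne_zero]
      ring
  refine (monic_X_pow (Fintype.card n)).isRegular.left ?_
  linear_combination X * charpoly_mul_charpoly_of_mul_eq_zero hmul - A.charpoly * hrank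

theorem cons_roots_charpoly_eq_cons_roots_charpoly_add_vecMulVec {F : Type*} [Field F]
    {A : Matrix n n F} {u v : n → F} (h : A *ᵥ u = 0) :
    (u ⬝ᵥ v) ::ₘ A.charpoly.roots = 0 ::ₘ (A + vecMulVec u v).charpoly.roots := by
  have hroots := congrArg roots (X_sub_C_mul_charpoly_eq_X_mul_charpoly_add_vecMulVec (v := v) h)
  rwa [roots_mul (mul_ne_zero (X_sub_C_ne_zero _) A.charpoly_monic.ne_zero),
    roots_mul (mul_ne_zero X_ne_zero (charpoly_monic _).ne_zero), roots_X_sub_C, roots_X,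
    Multiset.singleton_add, Multiset.singleton_add] at hroots

theorem cons_roots_charpoly_eq_cons_roots_charpoly_add_allOnes {A : Matrix n n ℂ}
    (h : A *ᵥ 1 = 0) :
    (Fintype.card n : ℂ) ::ₘ A.charpoly.roots = 0 ::ₘ (A + allOnes n).charpoly.roots := by
  rw [← one_dotProduct_one]
  exact cons_roots_charpoly_eq_cons_roots_charpoly_add_vecMulVec h

end Deflation

section SortedEigenvalues

variable {q : ℕ}

theorem map_eig_univ (A : Matrix (Fin q) (Fin q) ℂ) :
    Finset.univ.val.map (eig A) = A.charpoly.roots := by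
  rw [Fin.univ_val_map, ← eigList_coe]
  congr 1
  exact List.ext_get (by simp [eigList_length]) (by simp [eig])

theorem lt_eig_re_iff (A : Matrix (Fin q) (Fin q) ℂ) (i : Fin q) (r : ℝ) :
    r < (eig A i).re ↔ (A.charpoly.roots.filter fun c => c.re ≤ r).card ≤ i := by
  have hcard : (A.charpoly.roots.filter fun c => c.re ≤ r).card
      = (Finset.univ.filter fun j => (eig A j).re ≤ r).card := by
    rw [← map_eig_univ, Multiset.filter_map, Multiset.card_map]
    rfl
  rw [hcard]
  constructor
  · intro h
    rw [← Fin.card_Iio]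
    refine Finset.card_le_card fun j hj => Finset.mem_Iio.2 ?_
    exact (eig_re_mono A).reflect_lt ((Finset.mem_filter.1 hj).2.trans_lt h)
  · contrapose!
    intro h
    rw [← Nat.succ_le_iff, ← Nat.add_one, ← Fin.card_Iic]
    exact Finset.card_le_card fun j hj => Finset.mem_filter.2
      ⟨Finset.mem_univ j, (eig_re_mono A (Finset.mem_Iic.1 hj)).trans h⟩

theorem eig_one_re_pos_iff (hq : 2 ≤ q) {A : Matrix (Fin q) (Fin q) ℂ} (h : A *ᵥ 1 = 0) :
    0 < (eig A ⟨1, hq⟩).re ↔ ∀ c ∈ (A + allOnes (Fin q)).charpoly.roots, 0 < c.re := by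
  have hcard := congrArg (fun s => (Multiset.filter (fun c : ℂ => c.re ≤ 0) s).card)
    (cons_roots_charpoly_eq_cons_roots_charpoly_add_allOnes h)
  have hq0 : ¬ ((Fintype.card (Fin q) : ℂ)).re ≤ 0 := by
    rw [Fintype.card_fin, Complex.natCast_re, not_le]
    exact_mod_cast zero_lt_two.trans_le hq
  beta_reduce at hcard
  rw [Multiset.filter_cons_of_neg (p := fun c : ℂ => c.re ≤ 0) _ hq0,
    Multiset.filter_cons_of_pos (p := fun c : ℂ => c.re ≤ 0) _ Complex.zero_re.le,
    Multiset.card_cons] at hcard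
  rw [lt_eig_re_iff, hcard]
  simp [Multiset.filter_eq_nil]

theorem eig_one_re_pos_iff_noUndampedMode (hq : 2 ≤ q) {P Q : Matrix (Fin q) (Fin q) ℂ}
    (hP : P.PosSemidef) (hQ : Q.IsHermitian) (hP1 : P *ᵥ 1 = 0) (hQ1 : Q *ᵥ 1 = 0) :
    0 < (eig (P + Complex.I • Q) ⟨1, hq⟩).re ↔ NoUndampedMode (P + allOnes (Fin q)) Q := by
  rw [eig_one_re_pos_iff hq (by rw [add_mulVec, smul_mulVec, hP1, hQ1, smul_zero, add_zero]),
    add_right_comm, forall_roots_add_I_smul_re_pos_iff (hP.add posSemidef_allOnes) hQ]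

theorem eig_im_eq_zero_of_isHermitian {A : Matrix (Fin q) (Fin q) ℂ} (hA : A.IsHermitian)
    (i : Fin q) : (eig A i).im = 0 := by
  have hmem : eig A i ∈ A.charpoly.roots :=
    map_eig_univ A ▸ Multiset.mem_map_of_mem _ (Finset.mem_univ i)
  rw [hA.roots_charpoly_eq_eigenvalues] at hmem
  obtain ⟨j, -, hj⟩ := Multiset.mem_map.1 hmem
  rw [← hj]
  exact Complex.ofReal_im _

end SortedEigenvalues

section Laplacian

variable {q : ℕ} {W : Fin q → Fin q → ℝ}

theorem lap_mulVec_apply (hdiag : ∀ i, W i i = 0) (x : Fin q → ℂ) (i : Fin q) :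
    (toC (lap W) *ᵥ x) i = ∑ j, (W i j : ℂ) * (x i - x j) := by
  have hlap : toC (lap W) =
      diagonal (fun i => ∑ l, (W i l : ℂ)) - Matrix.of fun i j => (W i j : ℂ) := by
    ext i j
    by_cases hij : i = j
    · subst hij
      simp [toC, lap, hdiag]
    · simp [toC, lap, hij]
  rw [hlap, sub_mulVec, Pi.sub_apply, mulVec_diagonal]
  simp only [mulVec, dotProduct, of_apply, mul_sub, Finset.sum_sub_distrib, Finset.sum_mul]

theorem lap_mulVec_one (hdiag : ∀ i, W i i = 0) : toC (lap W) *ᵥ 1 = 0 := by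
  ext i
  simp [lap_mulVec_apply hdiag]

theorem isHermitian_lap (hsymm : ∀ i j, W i j = W j i) : (toC (lap W)).IsHermitian := by
  ext i j
  by_cases hij : i = j
  · subst hij
    simp [toC, lap]
  · simp [toC, lap, hij, Ne.symm hij, hsymm i j]

theorem two_mul_star_dotProduct_lap_mulVec (hsymm : ∀ i j, W i j = W j i)
    (hdiag : ∀ i, W i i = 0) (x : Fin q → ℂ) :
    2 * (star x ⬝ᵥ toC (lap W) *ᵥ x)
      = ∑ i, ∑ j, (W i j : ℂ) * (star (x i - x j) * (x i - x j)) := by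
  have hform : star x ⬝ᵥ toC (lap W) *ᵥ x
      = ∑ i, ∑ j, (W i j : ℂ) * (star (x i) * (x i - x j)) := by
    simp only [dotProduct, lap_mulVec_apply hdiag, Finset.mul_sum, Pi.star_apply, mul_left_comm]
  have hswap : star x ⬝ᵥ toC (lap W) *ᵥ x
      = ∑ i, ∑ j, (W i j : ℂ) * (star (x j) * (x j - x i)) := by
    rw [hform, Finset.sum_comm]
    simp only [hsymm]
  rw [two_mul]
  nth_rewrite 1 [hform]
  rw [hswap]
  simp only [← Finset.sum_add_distrib, star_sub]
  exact Finset.sum_congr rfl fun i _ => Finset.sum_congr rfl fun j _ => by ring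

theorem posSemidef_lap (hsymm : ∀ i j, W i j = W j i) (hnonneg : ∀ i j, 0 ≤ W i j)
    (hdiag : ∀ i, W i i = 0) : (toC (lap W)).PosSemidef := by
  refine .of_dotProduct_mulVec_nonneg (isHermitian_lap hsymm) fun x => ?_
  rw [← inv_mul_cancel_left₀ (two_ne_zero' ℂ) (star x ⬝ᵥ _),
    two_mul_star_dotProduct_lap_mulVec hsymm hdiag]
  refine mul_nonneg (inv_nonneg.2 zero_le_two) ?_
  exact Finset.sum_nonneg fun i _ => Finset.sum_nonneg fun j _ =>
    mul_nonneg (Complex.zero_le_real.2 (hnonneg i j)) (star_mul_self_nonneg _)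

theorem normLap_mulVec_one (m : ℝ) (hdiag : ∀ i, W i i = 0) : toC (normLap m W) *ᵥ 1 = 0 :=
  lap_mulVec_one fun i => by simp [hdiag]

theorem isHermitian_normLap (m : ℝ) (hsymm : ∀ i j, W i j = W j i) :
    (toC (normLap m W)).IsHermitian :=
  isHermitian_lap fun i j => by rw [hsymm]

theorem toC_normLap_zero (m : ℝ) : toC (normLap (q := q) m 0) = 0 := by
  ext i j
  simp [toC, normLap, lap]

theorem posSemidef_normLap (m : ℝ) (hsymm : ∀ i j, W i j = W j i) (hnonneg : ∀ i j, 0 ≤ W i j)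
    (hdiag : ∀ i, W i i = 0) : (toC (normLap m W)).PosSemidef :=
  posSemidef_lap (fun i j => by rw [hsymm])
    (fun i j => by have := hnonneg i j; positivity) fun i => by simp [hdiag]

theorem normLap_mulVec_apply {m : ℝ} (hm : 0 ≤ m) (hdiag : ∀ i, W i i = 0) (x : Fin q → ℂ)
    (i : Fin q) : (toC (normLap m W) *ᵥ x) i = (m : ℂ)⁻¹ * ∑ j, (W i j : ℂ) * (x i - x j) := by
  have hsqrt : ((√m : ℝ) : ℂ)⁻¹ * ((√m : ℝ) : ℂ)⁻¹ = (m : ℂ)⁻¹ := by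
    rw [← mul_inv, ← Complex.ofReal_mul, Real.mul_self_sqrt hm]
  rw [normLap, lap_mulVec_apply (by simp [hdiag]), Finset.mul_sum]
  refine Finset.sum_congr rfl fun j _ => ?_
  push_cast
  linear_combination (W i j : ℂ) * (x i - x j) * hsqrt

end Laplacian

section Array

variable {q : ℕ} {m k : ℝ} {D R : Fin q → Fin q → ℝ}

/-- The stiffness matrix `k/m + L_r` of the array, whose equations of motion read
`x'' + L_d x' + (k/m + L_r) x = 0` after division by the mass. -/
noncomputable def stiffness (m k : ℝ) (R : Fin q → Fin q → ℝ) : Matrix (Fin q) (Fin q) ℂ :=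
  ((k / m : ℝ) : ℂ) • 1 + toC (normLap m R)

theorem posDef_stiffness (hm : 0 < m) (hk : 0 < k) (hsymm : ∀ i j, R i j = R j i)
    (hnonneg : ∀ i j, 0 ≤ R i j) (hdiag : ∀ i, R i i = 0) : (stiffness m k R).PosDef :=
  (PosDef.one.smul (Complex.zero_lt_real.2 (div_pos hk hm))).add_posSemidef
    (posSemidef_normLap m hsymm hnonneg hdiag)

theorem commute_allOnes_stiffness (hsymm : ∀ i j, R i j = R j i) (hdiag : ∀ i, R i i = 0) :
    Commute (allOnes (Fin q)) (stiffness m k R) := by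
  have hR1 := normLap_mulVec_one m hdiag
  refine ((Commute.one_right _).smul_right _).add_right ?_
  rw [Commute, SemiconjBy, allOnes_mul_eq_zero (isHermitian_normLap m hsymm) hR1,
    mul_allOnes_eq_zero hR1]

theorem add_normLap_mulVec_add_stiffness_mulVec_apply (hm : 0 < m) (hDdiag : ∀ i, D i i = 0)
    (hRdiag : ∀ i, R i i = 0) (x v a : Fin q → ℂ) (i : Fin q) :
    (a + toC (normLap m D) *ᵥ v + stiffness m k R *ᵥ x) i = (m : ℂ)⁻¹ *
      (m * a i + k * x i + ∑ j, (D i j : ℂ) * (v i - v j) + ∑ j, (R i j : ℂ) * (x i - x j)) := by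
  have hmC : (m : ℂ) ≠ 0 := Complex.ofReal_ne_zero.2 hm.ne'
  simp only [stiffness, add_mulVec, smul_mulVec, one_mulVec, Pi.add_apply, Pi.smul_apply,
    smul_eq_mul, normLap_mulVec_apply hm.le hDdiag, normLap_mulVec_apply hm.le hRdiag]
  push_cast
  field_simp
  ring

theorem IsSolution.isMotion_ofReal (hm : 0 < m) (hDdiag : ∀ i, D i i = 0)
    (hRdiag : ∀ i, R i i = 0) {x : Fin q → ℝ → ℝ} (hx : IsSolution m k D R x) :
    IsMotion (toC (normLap m D)) (stiffness m k R) fun t i => (x i t : ℂ) := by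
  obtain ⟨v, a, hv, ha, heq⟩ := hx
  refine ⟨fun t i => v i t, fun t i => a i t,
    fun t => hasDerivAt_pi.2 fun i => (hv i t).ofReal_comp,
    fun t => hasDerivAt_pi.2 fun i => (ha i t).ofReal_comp, fun t => funext fun i => ?_⟩
  rw [add_normLap_mulVec_add_stiffness_mulVec_apply hm hDdiag hRdiag]
  have hi := heq i t
  exact mul_eq_zero_of_right _ (by beta_reduce; exact_mod_cast hi)

theorem IsMotion.isSolution_re (hm : 0 < m) (hDdiag : ∀ i, D i i = 0) (hRdiag : ∀ i, R i i = 0)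
    {y : ℝ → Fin q → ℂ} (hy : IsMotion (toC (normLap m D)) (stiffness m k R) y) :
    IsSolution m k D R fun i t => (y t i).re := by
  obtain ⟨v, a, hv, ha, heq⟩ := hy
  have hre : ∀ {f g : ℝ → Fin q → ℂ}, (∀ t, HasDerivAt f (g t) t) →
      ∀ i t, HasDerivAt (fun t => (f t i).re) (g t i).re t := fun h i t =>
    Complex.reCLM.hasFDerivAt.comp_hasDerivAt t (hasDerivAt_pi.1 (h t) i)
  refine ⟨fun i t => (v t i).re, fun i t => (a t i).re, hre hv, hre ha, fun i t => ?_⟩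
  have hi := congrFun (heq t) i
  rw [add_normLap_mulVec_add_stiffness_mulVec_apply hm hDdiag hRdiag] at hi
  have hzero := (mul_eq_zero.1 hi).resolve_left (inv_ne_zero (Complex.ofReal_ne_zero.2 hm.ne'))
  simpa using congrArg Complex.re hzero

theorem synchronizes_iff_forall_isMotion (hm : 0 < m) (hDdiag : ∀ i, D i i = 0)
    (hRdiag : ∀ i, R i i = 0) :
    Synchronizes m k D R ↔ ∀ y, IsMotion (toC (normLap m D)) (stiffness m k R) y →
      ∀ i j, Tendsto (fun t => y t i - y t j) atTop (𝓝 0) := by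
  constructor
  · intro hsync y hy i j
    have hre : ∀ {z : ℝ → Fin q → ℂ}, IsMotion (toC (normLap m D)) (stiffness m k R) z →
        Tendsto (fun t => (z t i - z t j).re) atTop (𝓝 0) := fun hz => by
      simpa using (tendsto_zero_iff_abs_tendsto_zero _).2
        (hsync _ (hz.isSolution_re hm hDdiag hRdiag) i j)
    have him : Tendsto (fun t => (y t i - y t j).im) atTop (𝓝 0) := by
      simpa [neg_mulVec, smul_mulVec, ← sub_eq_add_neg] using
        hre (hy.mulVec (T := (-Complex.I) • 1) (by simp) (by simp))
    have hcomplex := (Complex.continuous_ofReal.tendsto 0).comp (hre hy) |>.add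
      (((Complex.continuous_ofReal.tendsto 0).comp him).mul_const Complex.I)
    rw [Complex.ofReal_zero, zero_mul, add_zero] at hcomplex
    exact hcomplex.congr fun t => Complex.re_add_im _
  · intro h x hx i j
    simpa [← Complex.ofReal_sub] using (h _ (hx.isMotion_ofReal hm hDdiag hRdiag) i j).norm

theorem synchronizes_iff_noUndampedMode (hm : 0 < m) (hk : 0 < k)
    (hDsymm : ∀ i j, D i j = D j i) (hDnonneg : ∀ i j, 0 ≤ D i j) (hDdiag : ∀ i, D i i = 0)
    (hRsymm : ∀ i j, R i j = R j i) (hRnonneg : ∀ i j, 0 ≤ R i j) (hRdiag : ∀ i, R i i = 0) :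
    Synchronizes m k D R ↔
      NoUndampedMode (toC (normLap m D) + allOnes (Fin q)) (toC (normLap m R)) := by
  rw [synchronizes_iff_forall_isMotion hm hDdiag hRdiag,
    forall_isMotion_tendsto_sub_iff (posSemidef_normLap m hDsymm hDnonneg hDdiag)
      (normLap_mulVec_one m hDdiag) (posDef_stiffness hm hk hRsymm hRnonneg hRdiag)
      (commute_allOnes_stiffness hRsymm hRdiag),
    stiffness, noUndampedMode_smul_one_add_iff]

theorem synchronizes_iff_eig_one_re_pos (hq : 2 ≤ q) (hm : 0 < m) (hk : 0 < k)
    (hDsymm : ∀ i j, D i j = D j i) (hDnonneg : ∀ i j, 0 ≤ D i j) (hDdiag : ∀ i, D i i = 0)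
    (hRsymm : ∀ i j, R i j = R j i) (hRnonneg : ∀ i j, 0 ≤ R i j) (hRdiag : ∀ i, R i i = 0) :
    Synchronizes m k D R ↔
      0 < (eig (toC (normLap m D) + Complex.I • toC (normLap m R)) ⟨1, hq⟩).re := by
  rw [synchronizes_iff_noUndampedMode hm hk hDsymm hDnonneg hDdiag hRsymm hRnonneg hRdiag,
    eig_one_re_pos_iff_noUndampedMode hq (posSemidef_normLap m hDsymm hDnonneg hDdiag)
      (isHermitian_normLap m hRsymm) (normLap_mulVec_one m hDdiag) (normLap_mulVec_one m hRdiag)]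

end Array

end OscillatorArray

theorem mainTheorem8 (q : ℕ) (hq : 2 ≤ q) (m k : ℝ) (hm : 0 < m) (hk : 0 < k)
    (D R : Fin q → Fin q → ℝ)
    (hDsymm : ∀ i j, D i j = D j i) (hDnonneg : ∀ i j, 0 ≤ D i j) (hDdiag : ∀ i, D i i = 0)
    (hRsymm : ∀ i j, R i j = R j i) (hRnonneg : ∀ i j, 0 ≤ R i j) (hRdiag : ∀ i, R i i = 0) :
    (OscillatorArray.Synchronizes m k D R ↔
      0 < (OscillatorArray.eig
        (OscillatorArray.toC (OscillatorArray.normLap m D)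
          + Complex.I • OscillatorArray.toC (OscillatorArray.normLap m R)) ⟨1, hq⟩).re) ∧
    ((∀ i j, R i j = 0) →
      (OscillatorArray.eig (OscillatorArray.toC (OscillatorArray.normLap m D)) ⟨1, hq⟩).im = 0 ∧
      (OscillatorArray.Synchronizes m k D R ↔
        0 < (OscillatorArray.eig
          (OscillatorArray.toC (OscillatorArray.normLap m D)) ⟨1, hq⟩).re)) := by
  have hsync := OscillatorArray.synchronizes_iff_eig_one_re_pos hq hm hk hDsymm hDnonneg hDdiag
    hRsymm hRnonneg hRdiag
  refine ⟨hsync, fun hR => ⟨?_, ?_⟩⟩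
  · exact OscillatorArray.eig_im_eq_zero_of_isHermitian
      (OscillatorArray.isHermitian_normLap m hDsymm) _
  · obtain rfl : R = 0 := funext₂ hR
    rwa [OscillatorArray.toC_normLap_zero, smul_zero, add_zero] at hsync
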